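/- **Definitions.** An *arrow algebra* $\mathcal A=(A,\le,\to,S)$ is a complete meet-semilattice $(A,\le)$ with a binary operation $\to$ (associating to the right) that is antitone in its first and monotone in its second argument, and a subset $S\subseteq A$ (the separator) that is upward closed, closed under modus ponens ($a\to b\in S$ and $a\in S$ imply $b\in S$), and contains $$\bigwedge_{a,b}a\to b\to a,\qquad \bigwedge_{a,b,c}(a\to b\to c)\to(a\to b)\to(a\to c),$$ $$\bigwedge_{a,(b_i)_{i\in I},(c_i)_{i\in I}}\Big(\bigwedge_{i\in I}(a\to b_i\to c_i)\Big)\to a\to\bigwedge_{i\in I}(b_i\to c_i).$$ An *implicative morphism* $f:\mathcal A\to\mathcal B$ is a function $f:A\to B$ such that (i) $f(S_A)\subseteq S_B$; (ii) there is $r\in S_B$ with $r\le f(a\to a')\to f(a)\to f(a')$ for all $a,a'\in A$; (iii) for every $X\subseteq A\times A$, if $\bigwedge_{(a,a')\in X}(a\to a')\in S_A$ then $\bigwedge_{(a,a')\in X}(f(a)\to f(a'))\in S_B$. For implicative morphisms $f,f':\mathcal A\to\mathcal B$ write $f\vdash f'$ if there is $u\in S_B$ with $u\le f(a)\to f'(a)$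 for all $a\in A$. Arrow algebras, implicative morphisms and $\vdash$ form the preorder-enriched category $\mathrm{ArrAlg}$ (a category whose hom-sets are preordered so that composition is order-preserving). A *tripos* is a pseudofunctor $P$ from $\mathrm{Set}^{\mathrm{op}}$ to Heyting prealgebras (preorders whose poset reflection is a Heyting algebra, with the monotone maps that preserve finite meets, finite joins and implications up to isomorphism) such that every $P(f)$ has a left and a right adjoint among monotone maps, the Beck–Chevalley condition holds for all pullback squares of sets, and there is a generic element, i.e. some $\sigma\in P(\Sigma)$ such that every $\phi\in P(X)$ is isomorphic to $P(c)(\sigma)$ for some $c:X\to\Sigma$. A *transformation* $\Phi:P\to Q$ of triposes is a family of monotone maps $\Phi_X:P(X)\to Q(X)$, natural up to isomorphism; it is *cartesian* if every $\Phi_X$ preserves finite meets up to isomorphism. Transformations are ordered pointwise, $\Phi\le\Psi$ iff $\Phi_X(\phi)\le\Psi_X(\phi)$ for all $X$ and $\phi$. Triposes and cartesian transformations form the preorder-enriched category $\mathrm{Trip}_{\mathrm{cart}}(\mathrm{Set})$. A *2-functor* between preorder-enriched categories is a functor that is order-preserving on hom-sets; it is *2-fully faithful* if all the monotone maps it induces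 between hom-preorders are equivalences of preorder categories (i.e. reflect the order and are surjective up to isomorphism). For an arrow algebra $\mathcal A$, let $P_{\mathcal A}(I)$ be the set $A^I$ of functions $I\to A$, preordered by $\phi\vdash_I\psi$ iff $\bigwedge_{i\in I}(\phi(i)\to\psi(i))\in S_A$, with reindexing along functions given by precomposition. **Proposition.** For every arrow algebra $\mathcal A$, $P_{\mathcal A}$ is a tripos. For every implicative morphism $f:\mathcal A\to\mathcal B$, the maps $(\Phi_f^+)_I(\phi):=f\circ\phi$ form a cartesian transformation $\Phi_f^+:P_{\mathcal A}\to P_{\mathcal B}$. The assignment $\mathcal A\mapsto P_{\mathcal A}$, $f\mapsto\Phi_f^+$ is a 2-fully faithful 2-functor $$\mathrm{ArrAlg}\longrightarrow\mathrm{Trip}_{\mathrm{cart}}(\mathrm{Set});$$ that is, it is a 2-functor, and for all arrow algebras $\mathcal A,\mathcal B$ the map $f\mapsto\Phi_f^+$ is an equivalence of preorder categories $$\mathrm{ArrAlg}(\mathcal A,\mathcal B)\simeq\mathrm{Trip}_{\mathrm{cart}}(\mathrm{Set})(P_{\mathcal A},P_{\mathcal B}).$$ -/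

import Mathlib

universe u v w

open CategoryTheory

/-! ### Preorder-enriched categories -/

/-- A preorder-enriched category: every hom-set carries a preorder, and composition is
order-preserving. -/
class PreorderEnriched (C : Type u) [Category.{v} C] where
  homPreorder (X Y : C) : Preorder (X ⟶ Y)
  comp_mono {X Y Z : C} {f f' : X ⟶ Y} {g g' : Y ⟶ Z} :
    f ≤ f' → g ≤ g' → f ≫ g ≤ f' ≫ g'

attribute [instance, reducible] PreorderEnriched.homPreorder

/-- A 2-functor between preorder-enriched categories: a functor (identities and composites are
preserved on the nose) which is order-preserving on every hom-set. -/
structure TwoFunctor (C : Type*) [Category C] [PreorderEnriched C]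
    (D : Type*) [Category D] [PreorderEnriched D] extends Functor C D where
  map_mono (X Y : C) : Monotone (fun f : X ⟶ Y => map f)

/-- The functor induced by a 2-functor between the hom-preorders, which are regarded as thin
categories. -/
def TwoFunctor.homFunctor {C : Type*} [Category C] [PreorderEnriched C]
    {D : Type*} [Category D] [PreorderEnriched D] (F : TwoFunctor C D) (X Y : C) :
    (X ⟶ Y) ⥤ (F.obj X ⟶ F.obj Y) :=
  (F.map_mono X Y).functor

/-- A 2-functor is 2-fully faithful if it induces an equivalence of preorder categories on all
hom-preorders. -/
def TwoFunctor.IsTwoFullyFaithful {C : Type*} [Category C] [PreorderEnriched C]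
    {D : Type*} [Category D] [PreorderEnriched D] (F : TwoFunctor C D) : Prop :=
  ∀ X Y : C, (F.homFunctor X Y).IsEquivalence

/-! ### Heyting prealgebras -/

/-- `e` is a Heyting implication `a ⇨ b` in a preorder: `c ≤ e` iff `c ∧ a ≤ b`. -/
def IsHeytingImp {α : Type*} [Preorder α] (a b e : α) : Prop :=
  ∀ c m : α, IsGLB {c, a} m → (c ≤ e ↔ m ≤ b)

/-- A Heyting prealgebra: a preorder with finite meets, finite joins and Heyting implications
(all of them determined up to isomorphism only), i.e. a preorder whose poset reflection is a
Heyting algebra. -/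
structure IsHeytingPrealgebra (α : Type*) [Preorder α] : Prop where
  exists_top : ∃ t : α, IsTop t
  exists_bot : ∃ t : α, IsBot t
  exists_meet (a b : α) : ∃ m, IsGLB {a, b} m
  exists_join (a b : α) : ∃ j, IsLUB {a, b} j
  exists_imp (a b : α) : ∃ e, IsHeytingImp a b e

/-- A map between preorders preserves finite meets (up to isomorphism). -/
structure PreservesFiniteMeets {α β : Type*} [Preorder α] [Preorder β] (f : α → β) : Prop where
  map_top {t : α} : IsTop t → IsTop (f t)
  map_meet {a b m : α} : IsGLB {a, b} m → IsGLB {f a, f b} (f m)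

/-- A morphism of Heyting prealgebras: a monotone map preserving finite meets, finite joins and
Heyting implications (up to isomorphism). -/
structure IsHeytingPreHom {α β : Type*} [Preorder α] [Preorder β] (f : α → β) : Prop
    extends PreservesFiniteMeets f where
  monotone : Monotone f
  map_bot {t : α} : IsBot t → IsBot (f t)
  map_join {a b j : α} : IsLUB {a, b} j → IsLUB {f a, f b} (f j)
  map_imp {a b e : α} : IsHeytingImp a b e → IsHeytingImp (f a) (f b) (f e)

/-! ### Triposes -/

/-- A pseudofunctor from `Setᵒᵖ` to the preorder-enriched category of preorders. Here
`AntisymmRel (· ≤ ·) a b` means `a ≤ b ∧ b ≤ a`. -/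
structure IndexedPreorder : Type (u + 1) where
  fiber : Type u → Type u
  preorder (X : Type u) : Preorder (fiber X)
  pull {X Y : Type u} (f : X → Y) : fiber Y → fiber X
  pull_mono {X Y : Type u} (f : X → Y) : Monotone (pull f)
  pull_id {X : Type u} (a : fiber X) : AntisymmRel (· ≤ ·) (pull (id : X → X) a) a
  pull_comp {X Y Z : Type u} (f : X → Y) (g : Y → Z) (a : fiber Z) :
    AntisymmRel (· ≤ ·) (pull (g ∘ f) a) (pull f (pull g a))

attribute [instance] IndexedPreorder.preorder

/-- The commutative square `h ∘ f = k ∘ g` is a pullback square of sets. -/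
def IsPullbackSquare {X Y Z W : Type u} (f : X → Y) (g : X → Z) (h : Y → W) (k : Z → W) : Prop :=
  h ∘ f = k ∘ g ∧ ∀ (y : Y) (z : Z), h y = k z → ∃! x : X, f x = y ∧ g x = z

/-- `P` is a tripos: it is a pseudofunctor into Heyting prealgebras, all reindexing maps have a
left adjoint and a right adjoint satisfying the Beck-Chevalley condition, and there is a generic
element. -/
structure IndexedPreorder.IsTripos (P : IndexedPreorder.{u}) : Prop where
  heyting (X : Type u) : IsHeytingPrealgebra (P.fiber X)
  heyting_pull {X Y : Type u} (f : X → Y) : IsHeytingPreHom (P.pull f)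
  exists_left {X Y : Type u} (f : X → Y) :
    ∃ E : P.fiber X → P.fiber Y, GaloisConnection E (P.pull f)
  exists_right {X Y : Type u} (f : X → Y) :
    ∃ U : P.fiber X → P.fiber Y, GaloisConnection (P.pull f) U
  beck_chevalley {X Y Z W : Type u} (f : X → Y) (g : X → Z) (h : Y → W) (k : Z → W) :
    IsPullbackSquare f g h k →
    ∀ (Ug : P.fiber X → P.fiber Z) (Uh : P.fiber Y → P.fiber W),
      GaloisConnection (P.pull g) Ug → GaloisConnection (P.pull h) Uh →
      ∀ a : P.fiber Y, AntisymmRel (· ≤ ·) (P.pull k (Uh a)) (Ug (P.pull f a))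
  exists_generic : ∃ (S : Type u) (s : P.fiber S), ∀ (X : Type u) (a : P.fiber X),
    ∃ c : X → S, AntisymmRel (· ≤ ·) a (P.pull c s)

/-- A (set-based) tripos. -/
structure Tripos : Type (u + 1) extends IndexedPreorder.{u} where
  isTripos : toIndexedPreorder.IsTripos

/-- A pseudonatural transformation between pseudofunctors `Setᵒᵖ → Preord`. -/
@[ext]
structure Transformation (P Q : IndexedPreorder.{u}) : Type (u + 1) where
  app (X : Type u) : P.fiber X → Q.fiber X
  app_mono (X : Type u) : Monotone (app X)
  naturality {X Y : Type u} (f : X → Y) (a : P.fiber Y) :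
    AntisymmRel (· ≤ ·) (app X (P.pull f a)) (Q.pull f (app Y a))

/-- A transformation is cartesian if each component preserves finite meets. -/
def Transformation.IsCartesian {P Q : IndexedPreorder.{u}} (t : Transformation P Q) : Prop :=
  ∀ X : Type u, PreservesFiniteMeets (t.app X)

/-- Transformations are ordered componentwise and pointwise. -/
instance (P Q : IndexedPreorder.{u}) : Preorder (Transformation P Q) where
  le s t := ∀ (X : Type u) (a : P.fiber X), s.app X a ≤ t.app X a
  le_refl _ _ _ := le_rfl
  le_trans _ _ _ h₁ h₂ X a := (h₁ X a).trans (h₂ X a)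

/-- The category `Trip(Set)` of triposes and transformations. -/
instance : Category.{u + 1} Tripos.{u} where
  Hom P Q := Transformation P.toIndexedPreorder Q.toIndexedPreorder
  id P :=
    { app := fun _ a => a
      app_mono := fun _ => monotone_id
      naturality := fun _ _ => AntisymmRel.rfl }
  comp {P Q R} s t :=
    { app := fun X a => t.app X (s.app X a)
      app_mono := fun X => (t.app_mono X).comp (s.app_mono X)
      naturality := fun {X Y} f a =>
        ⟨(t.app_mono X (s.naturality f a).1).trans (t.naturality f (s.app Y a)).1,
          (t.naturality f (s.app Y a)).2.trans (t.app_mono X (s.naturality f a).2)⟩ }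

instance : PreorderEnriched Tripos.{u} where
  homPreorder P Q :=
    inferInstanceAs (Preorder (Transformation P.toIndexedPreorder Q.toIndexedPreorder))
  comp_mono {_ _ _} _ f' g _ hf hg X a := (g.app_mono X (hf X a)).trans (hg X (f'.app X a))

/-- The class of cartesian transformations. -/
def cartesianTransformations : MorphismProperty Tripos.{u} :=
  fun _ _ t => Transformation.IsCartesian t

instance : (cartesianTransformations.{u}).IsMultiplicative where
  id_mem _ _ := ⟨fun h => h, fun h => h⟩
  comp_mem _ _ hs ht X :=
    ⟨fun h => (ht X).map_top ((hs X).map_top h), fun h => (ht X).map_meet ((hs X).map_meet h)⟩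

/-- `Trip_cart(Set)`: the wide subcategory of `Trip(Set)` on cartesian transformations. -/
abbrev TripCart : Type (u + 1) := WideSubcategory cartesianTransformations.{u}

instance : PreorderEnriched TripCart.{u} where
  homPreorder _ _ := Preorder.lift InducedWideCategory.Hom.hom
  comp_mono {X Y Z} _ _ _ _ hf hg :=
    PreorderEnriched.comp_mono (X := X.obj) (Y := Y.obj) (Z := Z.obj) hf hg

/-! ### Arrow algebras -/

/-- An arrow algebra. A complete meet-semilattice is the same as a complete lattice; only meets are
used below. The fields `imp_anti_mono` to `comb_a_mem` express that `imp` is an arrow structure and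
that `separator` is a separator on it. -/
class ArrowAlgebra (A : Type u) extends CompleteLattice A where
  imp : A → A → A
  imp_anti_mono {a a' b b' : A} : a' ≤ a → b ≤ b' → imp a b ≤ imp a' b'
  separator : Set A
  upward_closed {a b : A} : a ∈ separator → a ≤ b → b ∈ separator
  modus_ponens {a b : A} : imp a b ∈ separator → a ∈ separator → b ∈ separator
  comb_k_mem : (⨅ (a : A) (b : A), imp a (imp b a)) ∈ separator
  comb_s_mem : (⨅ (a : A) (b : A) (c : A),
    imp (imp a (imp b c)) (imp (imp a b) (imp a c))) ∈ separator
  comb_a_mem : (⨅ (a : A) (I : Type u) (b : I → A) (c : I → A),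
    imp (⨅ i, imp a (imp (b i) (c i))) (imp a (⨅ i, imp (b i) (c i)))) ∈ separator

namespace ArrowAlgebra

infixr:60 " ⇾ " => ArrowAlgebra.imp

variable {A : Type u} [ArrowAlgebra A] {I : Type u}

theorem family_mp {x y z : I → A} (h : (⨅ i, x i ⇾ y i ⇾ z i) ∈ separator (A := A))
    (hx : (⨅ i, x i) ∈ separator (A := A)) : (⨅ i, y i ⇾ z i) ∈ separator (A := A) := by
  have h1 : (⨅ i, (⨅ j, x j) ⇾ y i ⇾ z i) ∈ separator (A := A) :=
    upward_closed h (iInf_mono fun i => imp_anti_mono (iInf_le x i) le_rfl)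
  have h2 : ((⨅ i, (⨅ j, x j) ⇾ y i ⇾ z i) ⇾ (⨅ j, x j) ⇾ ⨅ i, y i ⇾ z i) ∈ separator (A := A) :=
    upward_closed comb_a_mem
      ((iInf_le _ (⨅ j, x j)).trans ((iInf_le _ I).trans ((iInf_le _ y).trans (iInf_le _ z))))
  exact modus_ponens (modus_ponens h2 h1) hx

theorem family_k (x y : I → A) : (⨅ i, x i ⇾ y i ⇾ x i) ∈ separator (A := A) :=
  upward_closed comb_k_mem (le_iInf fun i => (iInf_le _ (x i)).trans (iInf_le _ (y i)))

theorem family_s (x y z : I → A) :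
    (⨅ i, (x i ⇾ y i ⇾ z i) ⇾ (x i ⇾ y i) ⇾ x i ⇾ z i) ∈ separator (A := A) :=
  upward_closed comb_s_mem
    (le_iInf fun i => (iInf_le _ (x i)).trans ((iInf_le _ (y i)).trans (iInf_le _ (z i))))

theorem family_refl (x : I → A) : (⨅ i, x i ⇾ x i) ∈ separator (A := A) :=
  family_mp (family_mp (family_s x (fun i => x i ⇾ x i) x) (family_k x fun i => x i ⇾ x i))
    (family_k x x)

theorem family_trans {x y z : I → A} (h₁ : (⨅ i, x i ⇾ y i) ∈ separator (A := A))
    (h₂ : (⨅ i, y i ⇾ z i) ∈ separator (A := A)) : (⨅ i, x i ⇾ z i) ∈ separator (A := A) :=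
  family_mp (family_mp (family_s x y z) (family_mp (family_k (fun i => y i ⇾ z i) x) h₂)) h₁

/-- The logical order on `A ^ I`: `φ ⊢_I ψ` iff `⨅ i, φ i ⇾ ψ i` lies in the separator. -/
def Entails (φ ψ : I → A) : Prop := (⨅ i, φ i ⇾ ψ i) ∈ separator (A := A)

end ArrowAlgebra

open ArrowAlgebra in
/-- The pseudofunctor `P_A` underlying the arrow tripos of an arrow algebra: `P_A(I)` is `A ^ I` with
the logical order, and reindexing is precomposition. -/
def arrowIndexedPreorder (A : Type u) [ArrowAlgebra A] : IndexedPreorder.{u} where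
  fiber I := I → A
  preorder I :=
    { le := Entails
      lt := fun φ ψ => Entails φ ψ ∧ ¬ Entails ψ φ
      le_refl := family_refl
      le_trans := fun _ _ _ => family_trans }
  pull f φ := φ ∘ f
  pull_mono {X Y} f φ ψ (h : Entails φ ψ) :=
    upward_closed h (le_iInf fun i => iInf_le (fun j => φ j ⇾ ψ j) (f i))
  pull_id φ := ⟨family_refl φ, family_refl φ⟩
  pull_comp f g φ := ⟨family_refl (φ ∘ g ∘ f), family_refl (φ ∘ g ∘ f)⟩

/-- An implicative morphism of arrow algebras. -/
@[ext]
structure ImplicativeMorphism (A B : Type u) [ArrowAlgebra A] [ArrowAlgebra B] : Type u where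
  toFun : A → B
  map_separator {a : A} : a ∈ ArrowAlgebra.separator (A := A) →
    toFun a ∈ ArrowAlgebra.separator (A := B)
  exists_realizer : ∃ r ∈ ArrowAlgebra.separator (A := B),
    ∀ a a' : A, r ≤ toFun (a ⇾ a') ⇾ toFun a ⇾ toFun a'
  map_entails (X : Set (A × A)) : (⨅ p ∈ X, p.1 ⇾ p.2) ∈ ArrowAlgebra.separator (A := A) →
    (⨅ p ∈ X, toFun p.1 ⇾ toFun p.2) ∈ ArrowAlgebra.separator (A := B)

namespace ImplicativeMorphism

open ArrowAlgebra

variable {A B C : Type u} [ArrowAlgebra A] [ArrowAlgebra B] [ArrowAlgebra C]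

theorem map_family (f : ImplicativeMorphism A B) {I : Type u} {φ ψ : I → A}
    (h : Entails φ ψ) : Entails (f.toFun ∘ φ) (f.toFun ∘ ψ) := by
  have := f.map_entails (Set.range fun i => (φ i, ψ i)) (by rwa [iInf_range])
  rwa [iInf_range] at this

/-- `f ⊢ f'`: there is `u` in the separator of `B` with `u ≤ f a ⇾ f' a` for all `a`. -/
instance : Preorder (ImplicativeMorphism A B) where
  le f f' := ∃ u ∈ separator (A := B), ∀ a : A, u ≤ f.toFun a ⇾ f'.toFun a
  le_refl f := ⟨_, family_refl f.toFun, fun a => iInf_le _ a⟩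
  le_trans f g h := fun ⟨_, hu, hu'⟩ ⟨_, hv, hv'⟩ =>
    ⟨_, family_trans (x := f.toFun) (y := g.toFun) (z := h.toFun)
      (upward_closed hu (le_iInf hu')) (upward_closed hv (le_iInf hv')), fun a => iInf_le _ a⟩

theorem le_iff {f f' : ImplicativeMorphism A B} : f ≤ f' ↔ Entails f.toFun f'.toFun :=
  ⟨fun ⟨_, hu, h⟩ => upward_closed hu (le_iInf h), fun h => ⟨_, h, fun a => iInf_le _ a⟩⟩

/-- The identity implicative morphism. -/
protected def id (A : Type u) [ArrowAlgebra A] : ImplicativeMorphism A A where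
  toFun a := a
  map_separator h := h
  exists_realizer := ⟨_, family_refl fun a : A => a, fun a a' => iInf_le _ (a ⇾ a')⟩
  map_entails _ h := h

/-- Composition of implicative morphisms. -/
protected def comp (f : ImplicativeMorphism A B) (g : ImplicativeMorphism B C) :
    ImplicativeMorphism A C where
  toFun a := g.toFun (f.toFun a)
  map_separator h := g.map_separator (f.map_separator h)
  exists_realizer := by
    obtain ⟨r, hr, hr'⟩ := f.exists_realizer
    obtain ⟨s, hs, hs'⟩ := g.exists_realizer
    have h1 : Entails (fun p : A × A => f.toFun (p.1 ⇾ p.2))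
        (fun p => f.toFun p.1 ⇾ f.toFun p.2) := upward_closed hr (le_iInf fun p => hr' p.1 p.2)
    have h2 : Entails (fun p : A × A => g.toFun (f.toFun p.1 ⇾ f.toFun p.2))
        (fun p => g.toFun (f.toFun p.1) ⇾ g.toFun (f.toFun p.2)) :=
      upward_closed hs (le_iInf fun p => hs' (f.toFun p.1) (f.toFun p.2))
    exact ⟨_, family_trans (g.map_family h1) h2,
      fun a a' => iInf_le (fun p : A × A => _ ⇾ _) (a, a')⟩
  map_entails X h := by
    rw [iInf_subtype'] at h ⊢
    exact g.map_family (f.map_family h)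

end ImplicativeMorphism

/-- A bundled arrow algebra. -/
structure ArrAlg : Type (u + 1) where
  carrier : Type u
  [str : ArrowAlgebra carrier]

attribute [instance] ArrAlg.str

/-- The category `ArrAlg` of arrow algebras and implicative morphisms. -/
instance : Category.{u} ArrAlg.{u} where
  Hom A B := ImplicativeMorphism A.carrier B.carrier
  id A := ImplicativeMorphism.id A.carrier
  comp f g := f.comp g

instance : PreorderEnriched ArrAlg.{u} where
  homPreorder A B := inferInstanceAs (Preorder (ImplicativeMorphism A.carrier B.carrier))
  comp_mono {A B C} f f' g g' hf hg := by
    refine ImplicativeMorphism.le_iff.2 (ArrowAlgebra.family_trans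
      (g.map_family (ImplicativeMorphism.le_iff.1 hf)) ?_)
    obtain ⟨u, hu, h⟩ := hg
    exact ArrowAlgebra.upward_closed hu (le_iInf fun a => h (f'.toFun a))

/-! ### The transformation induced by an implicative morphism -/

/-- Postcomposition with an implicative morphism `f`, as a transformation `P_A → P_B`. -/
def arrowTransformation {A B : ArrAlg.{u}} (f : A ⟶ B) :
    Transformation (arrowIndexedPreorder A.carrier) (arrowIndexedPreorder B.carrier) where
  app _ φ := ImplicativeMorphism.toFun f ∘ φ
  app_mono _ φ ψ h := ImplicativeMorphism.map_family f (φ := φ) (ψ := ψ) h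
  naturality _ _ := AntisymmRel.rfl

/-- The assignment `A ↦ P_A`, `f ↦ (φ ↦ f ∘ φ)` as an assignment on objects and morphisms from
`ArrAlg` to `Trip_cart(Set)`. To land there it needs that every `P_A` is a tripos and that
postcomposition with an implicative morphism is cartesian. -/
def arrowPrefunctor
    (hP : ∀ A : ArrAlg.{u}, (arrowIndexedPreorder A.carrier).IsTripos)
    (hf : ∀ (A B : ArrAlg.{u}) (f : A ⟶ B), (arrowTransformation f).IsCartesian) :
    Prefunctor ArrAlg.{u} TripCart.{u} where
  obj A := ⟨⟨arrowIndexedPreorder A.carrier, hP A⟩⟩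
  map {A B} f := ⟨arrowTransformation f, hf A B f⟩

/-! K and S give Hilbert-style deduction uniformly over a family. The third combinator moves an
antecedent inside an infinite meet, but only when the members of the meet are implications. Hence
`conj`, `disj`, `exis` and `univ` are all encoded as meets of implications. Reindexing lies between
the adjoints `exis` and `univ`, so it preserves finite meets and joins, and Beck–Chevalley holds for
`univ` as an equality.

Full faithfulness is a Yoneda argument. Each `φ : I → A` is the reindexing along `φ` of the identity
of `A`, so a transformation `t` is determined up to isomorphism by the function `t_A(id) : A → B`
(`Transformation.app_antisymmRel`). For this function, preservation of top gives condition (i),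
preservation of binary meets gives (ii) (`genericFun_imp`), and monotonicity gives (iii).
Conversely, (i) and (ii) make postcomposition cartesian, and (iii) makes it monotone. -/

namespace ArrowAlgebra

section Deduction

variable {A : Type u} [ArrowAlgebra A] {I : Type u}

/-! ### Natural deduction for families of elements of an arrow algebra -/

theorem top_mem : (⊤ : A) ∈ separator (A := A) :=
  upward_closed comb_k_mem le_top

theorem entails_of_mem (w : I → A) {x : I → A} (h : (⨅ i, x i) ∈ separator (A := A)) :
    Entails w x :=
  family_mp (family_k x w) h

theorem entails_const_of_mem (w : I → A) {a : A} (h : a ∈ separator (A := A)) :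
    Entails w fun _ => a :=
  entails_of_mem w (upward_closed h (le_iInf fun _ => le_rfl))

theorem entails_mp {w x y : I → A} (h : Entails w fun i => x i ⇾ y i) (hx : Entails w x) :
    Entails w y :=
  family_mp (family_mp (family_s w x y) h) hx

theorem entails_of_le {x y : I → A} (h : ∀ i, x i ≤ y i) : Entails x y :=
  upward_closed (family_refl x) (iInf_mono fun i => imp_anti_mono le_rfl (h i))

theorem entails_imp_trans {w x y z : I → A} (h₁ : Entails w fun i => x i ⇾ y i)
    (h₂ : Entails w fun i => y i ⇾ z i) : Entails w fun i => x i ⇾ z i := by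
  have h₃ : Entails w fun i => x i ⇾ y i ⇾ z i :=
    family_trans h₂ (family_k (fun i => y i ⇾ z i) x)
  exact entails_mp (family_trans h₃ (family_s x y z)) h₁

theorem entails_imp_swap {w x y z : I → A} (h : Entails w fun i => x i ⇾ y i ⇾ z i) :
    Entails w fun i => y i ⇾ x i ⇾ z i :=
  entails_imp_trans (entails_of_mem w (family_k y x)) (family_trans h (family_s x y z))

theorem entails_swap {w x y : I → A} (h : Entails w fun i => x i ⇾ y i) :
    Entails x fun i => w i ⇾ y i :=
  family_trans (family_k x w) (family_mp (family_s w x y) h)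

theorem entails_eval (x y : I → A) : Entails x fun i => (x i ⇾ y i) ⇾ y i :=
  entails_swap (family_refl fun i => x i ⇾ y i)

/-- The introduction rule for meets of implications, from the third combinator. The index type `J`
depends on `i` so that it can be a fibre of a function. -/
theorem entails_iInf_imp {w : I → A} {J : I → Type u} {b c : ∀ i, J i → A}
    (h : (⨅ (i) (j : J i), w i ⇾ b i j ⇾ c i j) ∈ separator (A := A)) :
    Entails w fun i => ⨅ j : J i, b i j ⇾ c i j := by
  refine family_mp (x := fun i => ⨅ j : J i, w i ⇾ b i j ⇾ c i j) ?_ h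
  exact upward_closed comb_a_mem (le_iInf fun i => (iInf_le _ (w i)).trans
    ((iInf_le _ (J i)).trans ((iInf_le _ (b i)).trans (iInf_le _ (c i)))))

/-- A family indexed by pairs `(i, c)` may be checked as a single entailment. -/
theorem entails_iInf_imp_of_prod {J : Type u} {w : I → A} {b c : I → J → A}
    (h : Entails (fun p : I × J => w p.1) fun p => b p.1 p.2 ⇾ c p.1 p.2) :
    Entails w fun i => ⨅ j, b i j ⇾ c i j := by
  refine entails_iInf_imp (J := fun _ => J) (upward_closed h ?_)
  exact le_iInf fun i => le_iInf fun j => iInf_le (fun p : I × J => _ ⇾ _ ⇾ _) (i, j)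

theorem Entails.comp {x y : I → A} (h : Entails x y) {J : Type u} (g : J → I) :
    Entails (fun j => x (g j)) fun j => y (g j) :=
  upward_closed h (le_iInf fun j => iInf_le (fun i => x i ⇾ y i) (g j))

theorem top_imp_entails (x : I → A) : Entails (fun i => ⊤ ⇾ x i) x :=
  entails_mp (x := fun _ => ⊤) (family_refl fun i => ⊤ ⇾ x i) (entails_const_of_mem _ top_mem)

/-! ### Logical connectives and quantifiers -/

/-- Binary meet for the logical order, in its second-order encoding. -/
def conj (a b : A) : A := ⨅ c : A, (a ⇾ b ⇾ c) ⇾ c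

/-- Binary join for the logical order, in its second-order encoding. -/
def disj (a b : A) : A := ⨅ c : A, (a ⇾ c) ⇾ (b ⇾ c) ⇾ c

/-- Universal quantification along a function. -/
def univ {X Y : Type u} (f : X → Y) (φ : X → A) (y : Y) : A :=
  ⨅ x : {x // f x = y}, ⊤ ⇾ φ x

/-- Existential quantification along a function, in its second-order encoding. -/
def exis {X Y : Type u} (f : X → Y) (φ : X → A) (y : Y) : A :=
  ⨅ c : A, (⨅ x : {x // f x = y}, φ x ⇾ c) ⇾ c

theorem conj_entails_left (x y : I → A) : Entails (fun i => conj (x i) (y i)) x :=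
  entails_mp (x := fun i => x i ⇾ y i ⇾ x i) (entails_of_le fun i => iInf_le _ (x i))
    (entails_of_mem _ (family_k x y))

theorem conj_entails_right (x y : I → A) : Entails (fun i => conj (x i) (y i)) y :=
  entails_mp (x := fun i => x i ⇾ y i ⇾ y i) (entails_of_le fun i => iInf_le _ (y i))
    (entails_of_mem _ (entails_of_mem x (family_refl y)))

theorem entails_conj {w x y : I → A} (hx : Entails w x) (hy : Entails w y) :
    Entails w fun i => conj (x i) (y i) := by
  refine entails_iInf_imp_of_prod ?_
  -- With `x ⇾ y ⇾ c` as the hypothesis, the goal is `w ⇾ c`: precomposing with `w ⇾ x` gives `w ⇾ y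
  -- ⇾ c`, and S consumes `w ⇾ y`.
  refine entails_swap (entails_mp (family_trans (entails_imp_trans
    (y := fun p => x p.1) ?_ ?_)
    (family_s (fun p : I × A => w p.1) (fun p => y p.1) fun p => p.2)) ?_)
  · exact entails_of_mem _ (hx.comp Prod.fst)
  · exact family_refl _
  · exact entails_of_mem _ (hy.comp Prod.fst)

/-- `entails_conj` needs a common antecedent for both components; keeping `y` as an inner antecedent
is what makes currying possible in `entails_imp_iff`. -/
theorem entails_pair (x y : I → A) : Entails x fun i => y i ⇾ conj (x i) (y i) := by
  have h : Entails (fun p : I × A => x p.1) fun p => y p.1 ⇾ (x p.1 ⇾ y p.1 ⇾ p.2) ⇾ p.2 :=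
    entails_imp_swap (entails_swap (family_refl fun p : I × A => x p.1 ⇾ y p.1 ⇾ p.2))
  refine family_trans (entails_iInf_imp_of_prod (b := fun i _ => y i)
    (c := fun i c => (x i ⇾ y i ⇾ c) ⇾ c) h) ?_
  -- The third combinator again, now with `y i` as the antecedent to be pulled out of the meet over
  -- `c`.
  exact upward_closed comb_a_mem (le_iInf fun i => (iInf_le _ (y i)).trans
    ((iInf_le _ A).trans ((iInf_le _ fun c => x i ⇾ y i ⇾ c).trans (iInf_le _ fun c => c))))

theorem entails_imp_iff {w x y : I → A} :
    (Entails w fun i => x i ⇾ y i) ↔ Entails (fun i => conj (w i) (x i)) y := by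
  refine ⟨fun h => entails_mp (family_trans (conj_entails_left w x) h) (conj_entails_right w x),
    fun h => entails_imp_trans ?_ (entails_of_mem w h)⟩
  exact entails_pair w x

theorem entails_disj_left (x y : I → A) : Entails x fun i => disj (x i) (y i) := by
  refine entails_iInf_imp_of_prod (entails_swap (entails_imp_trans (family_refl _) ?_))
  exact entails_of_mem _ (family_k (fun p : I × A => p.2) fun p => y p.1 ⇾ p.2)

theorem entails_disj_right (x y : I → A) : Entails y fun i => disj (x i) (y i) := by
  refine entails_iInf_imp_of_prod (entails_swap (entails_of_mem _ ?_))
  exact entails_eval (fun p : I × A => y p.1) fun p => p.2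

theorem disj_entails {x y z : I → A} (hx : Entails x z) (hy : Entails y z) :
    Entails (fun i => disj (x i) (y i)) z := by
  refine entails_mp (x := fun i => y i ⇾ z i) (entails_mp (x := fun i => x i ⇾ z i)
    (entails_of_le fun i => iInf_le _ (z i)) (entails_of_mem _ hx)) (entails_of_mem _ hy)

/-- The padding `⊤ ⇾ φ x` makes each member of the meet an implication, so that `entails_iInf_imp`
applies; K inserts it and `top_imp_entails` removes it. -/
theorem entails_univ_iff {X Y : Type u} (f : X → Y) {ψ : Y → A} {φ : X → A} :
    Entails (ψ ∘ f) φ ↔ Entails ψ (univ f φ) := by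
  constructor
  · intro h
    have h' : Entails (ψ ∘ f) fun x => ⊤ ⇾ φ x := family_trans h (family_k φ fun _ => ⊤)
    refine entails_iInf_imp (J := fun y => {x // f x = y}) (upward_closed h' ?_)
    refine le_iInf fun y => le_iInf fun ⟨x, hx⟩ => ?_
    -- Summing the fibres of `f` over all `y` recovers `X`, so the double meet is bounded below by
    -- the one over `X`.
    subst hx
    exact iInf_le (fun x => (ψ ∘ f) x ⇾ ⊤ ⇾ φ x) x
  · intro h
    refine family_trans (h.comp f) (family_trans (entails_of_le fun x => ?_) (top_imp_entails φ))
    exact iInf_le (fun x' : {x' // f x' = f x} => ⊤ ⇾ φ x') ⟨x, rfl⟩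

theorem exis_entails_iff {X Y : Type u} (f : X → Y) {φ : X → A} {ψ : Y → A} :
    Entails (exis f φ) ψ ↔ Entails φ (ψ ∘ f) := by
  constructor
  · intro h
    refine family_trans (entails_iInf_imp_of_prod ?_) (h.comp f)
    refine entails_swap (entails_of_le fun p => ?_)
    exact iInf_le (fun x : {x // f x = f p.1} => φ x ⇾ p.2) ⟨p.1, rfl⟩
  · intro h
    refine entails_mp (x := fun y => ⨅ x : {x // f x = y}, φ x ⇾ ψ y)
      (entails_of_le fun y => iInf_le _ (ψ y)) (entails_of_mem _ (upward_closed h ?_))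
    refine le_iInf fun y => le_iInf fun ⟨x, hx⟩ => ?_
    subst hx
    exact iInf_le (fun x => φ x ⇾ (ψ ∘ f) x) x

end Deduction

end ArrowAlgebra

open ArrowAlgebra

section ArrowTripos

variable {A : Type u} [ArrowAlgebra A] {I : Type u}

/-! ### The arrow tripos -/

theorem isTop_iff_entails {φ : (arrowIndexedPreorder A).fiber I} :
    IsTop φ ↔ Entails (fun _ => (⊤ : A)) (φ : I → A) :=
  ⟨fun h => h fun _ => (⊤ : A),
    fun h ψ => family_trans (entails_const_of_mem (ψ : I → A) top_mem) h⟩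

theorem isGLB_conj (φ ψ : (arrowIndexedPreorder A).fiber I) :
    IsGLB {φ, ψ} (fun i => conj (φ i) (ψ i) : (arrowIndexedPreorder A).fiber I) := by
  refine ⟨?_, fun c hc => entails_conj (hc (by simp)) (hc (by simp))⟩
  rintro c (rfl | rfl)
  · exact conj_entails_left _ _
  · exact conj_entails_right _ _

theorem isLUB_disj (φ ψ : (arrowIndexedPreorder A).fiber I) :
    IsLUB {φ, ψ} (fun i => disj (φ i) (ψ i) : (arrowIndexedPreorder A).fiber I) := by
  refine ⟨?_, fun c hc => disj_entails (hc (by simp)) (hc (by simp))⟩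
  rintro c (rfl | rfl)
  · exact entails_disj_left _ _
  · exact entails_disj_right _ _

theorem le_imp_iff_of_isGLB {a b c m : (arrowIndexedPreorder A).fiber I} (h : IsGLB {c, a} m) :
    c ≤ (fun i => a i ⇾ b i : (arrowIndexedPreorder A).fiber I) ↔ m ≤ b := by
  have h₁ := (isGLB_conj c a).2 h.1
  have h₂ := h.2 (isGLB_conj c a).1
  exact entails_imp_iff.trans ⟨fun h' => h₁.trans h', fun h' => h₂.trans h'⟩

/-- Reduces any Heyting implication to the pointwise arrow, with which precomposition commutes
strictly. -/
theorem isHeytingImp_iff {a b e : (arrowIndexedPreorder A).fiber I} :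
    IsHeytingImp a b e ↔ AntisymmRel (· ≤ ·) e
      (fun i => a i ⇾ b i : (arrowIndexedPreorder A).fiber I) := by
  refine ⟨fun h => ⟨?_, ?_⟩, fun h c m hm => ?_⟩
  · exact (le_imp_iff_of_isGLB (isGLB_conj e a)).2 ((h e _ (isGLB_conj e a)).1 le_rfl)
  · exact (h _ _ (isGLB_conj _ a)).2 ((le_imp_iff_of_isGLB (isGLB_conj _ a)).1 le_rfl)
  · rw [← le_imp_iff_of_isGLB hm]
    exact ⟨fun h' => h'.trans h.1, fun h' => h'.trans h.2⟩

theorem isBot_const_bot : IsBot (α := (arrowIndexedPreorder A).fiber I) fun _ => (⊥ : A) :=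
  fun φ => entails_of_le (x := fun _ => (⊥ : A)) (y := φ) fun _ => bot_le

theorem galoisConnection_exis {X Y : Type u} (f : X → Y) :
    GaloisConnection (α := (arrowIndexedPreorder A).fiber X)
      (β := (arrowIndexedPreorder A).fiber Y) (exis (A := A) f)
      ((arrowIndexedPreorder A).pull f) :=
  fun _ _ => exis_entails_iff f

theorem galoisConnection_univ {X Y : Type u} (f : X → Y) :
    GaloisConnection (α := (arrowIndexedPreorder A).fiber Y)
      (β := (arrowIndexedPreorder A).fiber X) ((arrowIndexedPreorder A).pull f)
      (univ (A := A) f) :=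
  fun _ _ => entails_univ_iff f

/-- As a right adjoint of `exis f`, reindexing preserves meets; as a left adjoint of `univ f`, it
preserves joins. -/
theorem isHeytingPreHom_pull {X Y : Type u} (f : X → Y) :
    IsHeytingPreHom ((arrowIndexedPreorder A).pull f) where
  map_top {t} h φ := (galoisConnection_exis f φ t).1 (h _)
  map_meet h := by simpa [Set.image_pair] using (galoisConnection_exis f).isGLB_u_image h
  monotone := (arrowIndexedPreorder A).pull_mono f
  map_bot {t} h φ := (galoisConnection_univ f t φ).2 (h _)
  map_join h := by simpa [Set.image_pair] using (galoisConnection_univ f).isLUB_l_image h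
  map_imp h := by
    have h' := isHeytingImp_iff.1 h
    exact isHeytingImp_iff.2
      ⟨(arrowIndexedPreorder A).pull_mono f h'.1, (arrowIndexedPreorder A).pull_mono f h'.2⟩

/-- In a pullback square `f` maps the fibre of `g` over `z` onto the fibre of `h` over `k z`, so
both meets have the same members. -/
theorem univ_comp_of_isPullbackSquare {X Y Z W : Type u} {f : X → Y} {g : X → Z} {h : Y → W}
    {k : Z → W} (H : IsPullbackSquare f g h k) (φ : Y → A) :
    univ h φ ∘ k = univ g (φ ∘ f) := by
  funext z
  refine le_antisymm (le_iInf fun ⟨x, hx⟩ => ?_) (le_iInf fun ⟨y, hy⟩ => ?_)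
  · have hy : h (f x) = k z := by rw [← hx]; exact congrFun H.1 x
    exact iInf_le (fun y : {y // h y = k z} => ⊤ ⇾ φ y) ⟨f x, hy⟩
  · obtain ⟨x, ⟨rfl, hx⟩, -⟩ := H.2 y z hy
    exact iInf_le (fun x : {x // g x = z} => ⊤ ⇾ (φ ∘ f) x) ⟨x, hx⟩

theorem GaloisConnection.antisymmRel_u {α β : Type*} [Preorder α] [Preorder β] {l : α → β}
    {u u' : β → α} (h : GaloisConnection l u) (h' : GaloisConnection l u') (b : β) :
    AntisymmRel (· ≤ ·) (u b) (u' b) :=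
  ⟨(h' _ _).1 (h.l_u_le b), (h _ _).1 (h'.l_u_le b)⟩

theorem isTripos_arrowIndexedPreorder (A : Type u) [ArrowAlgebra A] :
    (arrowIndexedPreorder A).IsTripos where
  heyting X :=
    { exists_top := ⟨fun _ => (⊤ : A), isTop_iff_entails.2 (family_refl _)⟩
      exists_bot := ⟨_, isBot_const_bot⟩
      exists_meet := fun a b => ⟨_, isGLB_conj a b⟩
      exists_join := fun a b => ⟨_, isLUB_disj a b⟩
      exists_imp := fun a b => ⟨_, isHeytingImp_iff.2 AntisymmRel.rfl⟩ }
  heyting_pull := isHeytingPreHom_pull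
  exists_left f := ⟨_, galoisConnection_exis f⟩
  exists_right f := ⟨_, galoisConnection_univ f⟩
  beck_chevalley f g h k H Ug Uh hg hh a := by
    -- The given right adjoints are arbitrary, so they are first compared with `univ`.
    have h₁ := hh.antisymmRel_u (galoisConnection_univ h) a
    have h₂ := (galoisConnection_univ g).antisymmRel_u hg ((arrowIndexedPreorder A).pull f a)
    have h₃ : (arrowIndexedPreorder A).pull k (univ (A := A) h a) =
      univ (A := A) g ((arrowIndexedPreorder A).pull f a) := univ_comp_of_isPullbackSquare H a
    have mono := (arrowIndexedPreorder A).pull_mono k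
    exact ⟨(mono h₁.1).trans (h₃.le.trans h₂.1), h₂.2.trans (h₃.ge.trans (mono h₁.2))⟩
  exists_generic := ⟨A, fun a => a, fun X a => ⟨a, AntisymmRel.rfl⟩⟩

end ArrowTripos

/-! ### Transformations between arrow triposes -/

theorem ImplicativeMorphism.map_imp {A B : Type u} [ArrowAlgebra A] [ArrowAlgebra B]
    (f : ImplicativeMorphism A B) {I : Type u} (x y : I → A) :
    Entails (fun i => f.toFun (x i ⇾ y i)) fun i => f.toFun (x i) ⇾ f.toFun (y i) := by
  obtain ⟨r, hr, h⟩ := f.exists_realizer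
  exact upward_closed hr (le_iInf fun i => h (x i) (y i))

theorem isCartesian_arrowTransformation {A B : ArrAlg.{u}} (f : A ⟶ B) :
    (arrowTransformation f).IsCartesian := by
  intro X
  have mono := (arrowTransformation f).app_mono X
  refine ⟨fun {t} h => ?_, fun {a b m} h => ⟨?_, fun c hc => ?_⟩⟩
  · have h₁ := mono (h fun _ => (⊤ : A.carrier))
    refine isTop_iff_entails.2 (family_trans ?_ h₁)
    exact entails_const_of_mem _ (ImplicativeMorphism.map_separator f top_mem)
  · rintro c (rfl | rfl)
    · exact mono (h.1 (by simp))
    · exact mono (h.1 (by simp))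
  · have h₁ := mono ((le_imp_iff_of_isGLB (b := m) h).2 le_rfl)
    have h₂ : Entails (c : X → B.carrier)
        fun i => ImplicativeMorphism.toFun f (b i) ⇾ ImplicativeMorphism.toFun f (m i) :=
      family_trans (hc (Or.inl rfl)) (family_trans h₁ (ImplicativeMorphism.map_imp f b m))
    exact entails_mp h₂ (hc (Or.inr rfl))

/-! ### Cartesian transformations come from implicative morphisms -/

section Representation

variable {A B : Type u} [ArrowAlgebra A] [ArrowAlgebra B]
  (t : Transformation (arrowIndexedPreorder A) (arrowIndexedPreorder B))

/-- The function underlying a transformation of arrow triposes: its value at the generic element. -/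
def Transformation.genericFun : A → B := t.app A fun a => a

/-- Naturality along `φ` itself, viewed as a map of sets `I → A`, at the identity of `A`. -/
theorem Transformation.app_antisymmRel {I : Type u} (φ : (arrowIndexedPreorder A).fiber I) :
    AntisymmRel (· ≤ ·) (t.app I φ)
      (fun i => t.genericFun (φ i) : (arrowIndexedPreorder B).fiber I) :=
  t.naturality (Y := A) φ fun a => a

theorem Transformation.genericFun_entails {I : Type u} {φ ψ : I → A} (h : Entails φ ψ) :
    Entails (fun i => t.genericFun (φ i)) fun i => t.genericFun (ψ i) :=
  (t.app_antisymmRel φ).2.trans ((t.app_mono I h).trans (t.app_antisymmRel ψ).1)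

variable {t}

theorem Transformation.IsCartesian.genericFun_mem (ht : t.IsCartesian) {a : A}
    (ha : a ∈ separator (A := A)) : t.genericFun a ∈ separator (A := B) := by
  -- Over the one-point set, being a top element amounts to membership in the separator.
  have h₁ : IsTop (α := (arrowIndexedPreorder A).fiber PUnit) fun _ => a :=
    isTop_iff_entails.2 (entails_const_of_mem _ ha)
  have h₂ : Entails (fun _ : PUnit => (⊤ : B)) fun _ => t.genericFun a :=
    family_trans (isTop_iff_entails.1 ((ht PUnit).map_top h₁)) (t.app_antisymmRel (I := PUnit) _).1
  exact modus_ponens (upward_closed h₂ (iInf_le _ PUnit.unit)) top_mem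

/-- After currying, this is the image under `t` of modus ponens, `(x ⇾ y) ∧ x ⊢ y`, since `t`
preserves the meet. -/
theorem Transformation.IsCartesian.genericFun_imp (ht : t.IsCartesian) {I : Type u}
    (x y : I → A) :
    Entails (fun i => t.genericFun (x i ⇾ y i))
      fun i => t.genericFun (x i) ⇾ t.genericFun (y i) := by
  refine entails_imp_iff.2 ?_
  have h₁ := (ht I).map_meet (isGLB_conj (A := A) (I := I) (fun i => x i ⇾ y i) x)
  have h₂ := (le_imp_iff_of_isGLB (isGLB_conj (A := A) (I := I) (fun i => x i ⇾ y i) x)).1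
    (le_refl (α := (arrowIndexedPreorder A).fiber I) fun i => x i ⇾ y i)
  refine family_trans (h₁.2 ?_) (family_trans (t.app_mono I h₂) (t.app_antisymmRel y).1)
  rintro c (rfl | rfl)
  · exact family_trans (conj_entails_left _ _)
      (t.app_antisymmRel (I := I) fun i => x i ⇾ y i).2
  · exact family_trans (conj_entails_right _ _) (t.app_antisymmRel (I := I) x).2

/-- A cartesian transformation of arrow triposes induces an implicative morphism. -/
def Transformation.IsCartesian.toImplicativeMorphism (ht : t.IsCartesian) :
    ImplicativeMorphism A B where
  toFun := t.genericFun
  map_separator := ht.genericFun_mem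
  -- Taking the generic pair over `A × A` yields one realizer that works for all `a` and `a'`.
  exists_realizer := ⟨_, ht.genericFun_imp (fun p : A × A => p.1) fun p => p.2,
    fun a a' => iInf_le (fun p : A × A => _ ⇾ _) (a, a')⟩
  map_entails X h := by
    rw [iInf_subtype'] at h ⊢
    exact t.genericFun_entails (I := X) h

end Representation

/-! ### The 2-functor and its full faithfulness -/

/-- The 2-functor sending an arrow algebra to its arrow tripos. -/
def arrowTwoFunctor : TwoFunctor ArrAlg.{u} TripCart.{u} where
  __ := arrowPrefunctor (fun A => isTripos_arrowIndexedPreorder A.carrier)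
    fun _ _ => isCartesian_arrowTransformation
  map_id _ := rfl
  map_comp _ _ := rfl
  map_mono _ _ _ _ h _ φ := (ImplicativeMorphism.le_iff.1 h).comp φ

theorem isTwoFullyFaithful_arrowTwoFunctor : arrowTwoFunctor.{u}.IsTwoFullyFaithful := by
  intro X Y
  have full : (arrowTwoFunctor.homFunctor X Y).Full := by
    refine ⟨fun {f f'} g => ⟨homOfLE ?_, Subsingleton.elim _ _⟩⟩
    -- The order is reflected by evaluating at the generic element.
    exact ImplicativeMorphism.le_iff.2 (leOfHom g X.carrier fun a : X.carrier => a)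
  have faithful : (arrowTwoFunctor.homFunctor X Y).Faithful :=
    ⟨fun _ => Subsingleton.elim _ _⟩
  have essSurj : (arrowTwoFunctor.homFunctor X Y).EssSurj := by
    refine ⟨fun t => ?_⟩
    have ht : Transformation.IsCartesian t.hom := t.property
    refine ⟨ht.toImplicativeMorphism, ⟨⟨homOfLE ?_, homOfLE ?_, Subsingleton.elim _ _,
      Subsingleton.elim _ _⟩⟩⟩
    · exact fun I φ => (Transformation.app_antisymmRel t.hom φ).2
    · exact fun I φ => (Transformation.app_antisymmRel t.hom φ).1
  exact { }

theorem proposition6p4 :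
    ∃ (hP : ∀ A : ArrAlg.{u}, (arrowIndexedPreorder A.carrier).IsTripos)
      (hf : ∀ (A B : ArrAlg.{u}) (f : A ⟶ B), (arrowTransformation f).IsCartesian)
      (F : TwoFunctor ArrAlg.{u} TripCart.{u}),
      F.toPrefunctor = arrowPrefunctor hP hf ∧ F.IsTwoFullyFaithful :=
  ⟨fun A => isTripos_arrowIndexedPreorder A.carrier, fun _ _ => isCartesian_arrowTransformation,
    arrowTwoFunctor, rfl, isTwoFullyFaithful_arrowTwoFunctor⟩
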